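/- Let $K$ be an algebraically closed field (of any characteristic) and let $f:\mathbb{P}^m\to\mathbb{P}^M$ be a nonconstant morphism over $K$. Let $\deg f$ be its degree, that is, the common degree of forms $F_0,\dots,F_M\in K[X_0,\dots,X_m]$ without common factor such that $f=(F_0:\dots:F_M)$. Let $\Gamma_f$ be the set of mapping symmetries of $f$, i.e. of all rational maps $\varphi:\mathbb{P}^m\dashrightarrow\mathbb{P}^m$ with $f\circ\varphi=f$. Identify the group $\operatorname{Aut}(\mathbb{P}^m)$ of invertible morphisms $\mathbb{P}^m\to\mathbb{P}^m$ with $\operatorname{PGL}_{m+1}(K)$, the class of a matrix $A$ acting by $[x]\mapsto[Ax]$; this identification is a bijection that carries products to compositions. Then: (i) $\Gamma_f$ is a finite subgroup of $\operatorname{Aut}(\mathbb{P}^m)\cong\operatorname{PGL}_{m+1}(K)$, of order at most $(\deg f)^M$. (ii) For every $\varphi\in\Gamma_f$ the critical locus $$\operatorname{Crit}(f)=\{P\in\mathbb{P}^m(K) : \operatorname{rank} f'(P)<m\},$$ where $f'(P):T_P\mathbb{P}^m\to T_{f(P)}\mathbb{P}^M$ is the differential of $f$ at $P$, satisfies $\varphi(\operatorname{Crit}(f))=\operatorname{Crit}(f)$.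 -/

import Mathlib

open MvPolynomial
open scoped LinearAlgebra.Projectivization MatrixGroups

namespace ProjectiveMaps

/-- The set of `K`-points of projective `n`-space. -/
abbrev PSpace (K : Type*) [Field K] (n : ℕ) : Type _ := ℙ K (Fin (n + 1) → K)

/-- A tuple `(Φ₀, …, Φₙ)` of forms of one common degree in the variables `X₀, …, Xₘ`, not all of
them zero: homogeneous coordinates of a rational map `ℙᵐ ⇢ ℙⁿ`, possibly with common factors. -/
structure FormTuple (K : Type*) [Field K] (m n : ℕ) where
  forms : Fin (n + 1) → MvPolynomial (Fin (m + 1)) K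
  degree : ℕ
  homogeneous : ∀ j, (forms j).IsHomogeneous degree
  ne_zero : ∃ j, forms j ≠ 0

/-- Two tuples are equivalent when they are proportional over the field of rational functions. -/
instance FormTuple.setoid (K : Type*) [Field K] (m n : ℕ) : Setoid (FormTuple K m n) where
  r Φ Ψ := ∀ i j, Φ.forms i * Ψ.forms j = Φ.forms j * Ψ.forms i
  iseqv :=
    { refl := fun Φ i j => mul_comm _ _
      symm := fun {Φ Ψ} h i j => by
        rw [mul_comm, mul_comm (Ψ.forms j)]
        exact h j i
      trans := fun {Φ Ψ Θ} h₁ h₂ i j => by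
        obtain ⟨k, hk⟩ := Ψ.ne_zero
        refine mul_left_cancel₀ hk ?_
        linear_combination (Θ.forms j) * h₁ i k + (Φ.forms k) * h₂ i j - (Θ.forms i) * h₁ j k }

/-- Rational maps `ℙᵐ ⇢ ℙⁿ` over `K`. -/
def RationalMap (K : Type*) [Field K] (m n : ℕ) : Type _ := Quotient (FormTuple.setoid K m n)

variable {K : Type*} [Field K] {m n l : ℕ}

/-- The value of the polynomial map `Φ : K^{m+1} → K^{n+1}` at a vector. -/
noncomputable def FormTuple.eval (Φ : FormTuple K m n) (x : Fin (m + 1) → K) : Fin (n + 1) → K :=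
  fun j => MvPolynomial.eval x (Φ.forms j)

/-- The Jacobian of the polynomial map `Φ : K^{m+1} → K^{n+1}` at the vector `x`. -/
noncomputable def FormTuple.jacobian (Φ : FormTuple K m n) (x : Fin (m + 1) → K) :
    (Fin (m + 1) → K) →ₗ[K] (Fin (n + 1) → K) :=
  Matrix.toLin' (Matrix.of fun j i => MvPolynomial.eval x (pderiv i (Φ.forms j)))

/-- Euler's identity. -/
theorem FormTuple.jacobian_self (Φ : FormTuple K m n) (x : Fin (m + 1) → K) :
    Φ.jacobian x x = (Φ.degree : K) • Φ.eval x := by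
  funext j
  have h := congrArg (MvPolynomial.eval x) (Φ.homogeneous j).sum_X_mul_pderiv
  simp only [map_sum, map_mul, eval_X, nsmul_eq_mul, map_natCast] at h
  simp only [jacobian, Matrix.toLin'_apply, Matrix.mulVec, dotProduct, Matrix.of_apply,
    Pi.smul_apply, smul_eq_mul, FormTuple.eval]
  rw [← h]
  exact Finset.sum_congr rfl fun i _ => mul_comm _ _

/-- The differential at the point `[x]` of the map `[x] ↦ [Φ(x)]`, where `Φ(x) ≠ 0`. The tangent
space of a projective space `ℙ(V)` at `[v]` is identified with `V / Kv`, which the choice of the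
vector `v` on the line makes possible, and the differential is induced by the Jacobian. -/
noncomputable def FormTuple.differential (Φ : FormTuple K m n) (x : Fin (m + 1) → K) :
    ((Fin (m + 1) → K) ⧸ Submodule.span K {x}) →ₗ[K]
      ((Fin (n + 1) → K) ⧸ Submodule.span K {Φ.eval x}) :=
  Submodule.mapQ _ _ (Φ.jacobian x) (by
    rw [Submodule.span_le, Set.singleton_subset_iff]
    change Φ.jacobian x x ∈ Submodule.span K {Φ.eval x}
    rw [Φ.jacobian_self]
    exact Submodule.smul_mem _ _ (Submodule.mem_span_singleton_self _))

namespace RationalMap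

/-- `Φ` is a tuple of homogeneous coordinates for the rational map `f`. -/
def Represents (Φ : FormTuple K m n) (f : RationalMap K m n) : Prop :=
  (Quotient.mk (FormTuple.setoid K m n) Φ : RationalMap K m n) = f

/-- `f` is defined at `P`, and `f(P) = Q`. -/
def MapsPoint (f : RationalMap K m n) (P : PSpace K m) (Q : PSpace K n) : Prop :=
  ∃ (Φ : FormTuple K m n) (x : Fin (m + 1) → K) (hx : x ≠ 0) (hΦ : Φ.eval x ≠ 0),
    Represents Φ f ∧ P = Projectivization.mk K x hx ∧ Q = Projectivization.mk K (Φ.eval x) hΦ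

/-- The domain of definition of a rational map. -/
def domain (f : RationalMap K m n) : Set (PSpace K m) := {P | ∃ Q, f.MapsPoint P Q}

/-- A morphism is a rational map that is defined at every point (over an algebraically closed
field). -/
def IsMorphism (f : RationalMap K m n) : Prop := f.domain = Set.univ

/-- `f` has only one value. -/
def IsConstant (f : RationalMap K m n) : Prop := ∃ Q, ∀ P ∈ f.domain, f.MapsPoint P Q

/-- The image of a set of points. -/
def image (f : RationalMap K m n) (S : Set (PSpace K m)) : Set (PSpace K n) :=
  {Q | ∃ P ∈ S, f.MapsPoint P Q}

/-- The degree of a rational map between projective spaces: the common degree of its homogeneous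
coordinates in lowest terms. -/
noncomputable def degree (f : RationalMap K m n) : ℕ :=
  sInf {d | ∃ Φ : FormTuple K m n, Represents Φ f ∧ Φ.degree = d}

/-- `g ∘ f` is defined as a rational map, and `g ∘ f = h`. That the substituted forms do not
all vanish identically is part of `Θ` being a `FormTuple`. -/
def IsComp (g : RationalMap K n l) (f : RationalMap K m n) (h : RationalMap K m l) : Prop :=
  ∃ (Ψ : FormTuple K n l) (Φ : FormTuple K m n) (Θ : FormTuple K m l),
    Represents Ψ g ∧ Represents Φ f ∧ Represents Θ h ∧
      ∀ j, Θ.forms j = bind₁ Φ.forms (Ψ.forms j)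

/-- The critical locus: the points `P` of `ℙᵐ` at which the differential of `f` has rank
less than `m`. -/
def criticalLocus (f : RationalMap K m n) : Set (PSpace K m) :=
  {P | ∃ (Φ : FormTuple K m n) (x : Fin (m + 1) → K) (hx : x ≠ 0), Φ.eval x ≠ 0 ∧
    Represents Φ f ∧ P = Projectivization.mk K x hx ∧
      Module.finrank K (LinearMap.range (Φ.differential x)) < m}

/-- The mapping symmetries of `f`: the rational self-maps `φ` of `ℙᵐ` with `f ∘ φ = f`. -/
def symmetries (f : RationalMap K m n) : Set (RationalMap K m m) := {φ | IsComp f φ f}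

end RationalMap

/-- The tuple of linear forms given by the rows of an invertible matrix. -/
noncomputable def FormTuple.ofGL (A : GL (Fin (m + 1)) K) : FormTuple K m m where
  forms i := ∑ j, C (A.val i j) * X j
  degree := 1
  homogeneous i := IsHomogeneous.sum _ _ _ fun j _ => isHomogeneous_C_mul_X _ _
  ne_zero := by
    by_contra! h
    have hz : A.val = 0 := by
      ext i k
      have := congrArg (MvPolynomial.eval (Pi.single k (1 : K))) (h i)
      simpa [Pi.single_apply] using this
    have h1 := A.mul_inv
    rw [hz, zero_mul] at h1
    exact zero_ne_one h1

namespace RationalMap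

/-- The identity of `ℙᵐ`. -/
noncomputable def identity (K : Type*) [Field K] (m : ℕ) : RationalMap K m m :=
  Quotient.mk _ (FormTuple.ofGL 1)

/-- The projective transformation `[x] ↦ [A x]` given by the class of a matrix `A`. -/
noncomputable def ofPGL (g : PGL(Fin (m + 1), K)) : RationalMap K m m :=
  Quotient.lift (s := QuotientGroup.leftRel (Subgroup.center (GL (Fin (m + 1)) K)))
    (fun A => (Quotient.mk (FormTuple.setoid K m m) (FormTuple.ofGL A) : RationalMap K m m))
    (by
      intro A B hAB
      obtain ⟨u, rfl⟩ := Matrix.ProjGenLinGroup.mk_eq_mk_iff.1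
        (show Matrix.ProjGenLinGroup.mk A = Matrix.ProjGenLinGroup.mk B from Quotient.sound hAB)
      have key : ∀ i, (FormTuple.ofGL (A * .scalar (Fin (m + 1)) u)).forms i
          = C (u : K) * (FormTuple.ofGL A).forms i := by
        intro i
        simp only [FormTuple.ofGL, Finset.mul_sum]
        refine Finset.sum_congr rfl fun j _ => ?_
        have : (A * .scalar (Fin (m + 1)) u).val i j = u * A.val i j := by
          simp [Matrix.GeneralLinearGroup.scalar, mul_comm]
        rw [this, C_mul, mul_assoc]
      refine Quotient.sound fun i j => ?_
      rw [key, key]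
      ring) g

/-- The automorphisms of `ℙᵐ`: the morphisms `ℙᵐ → ℙᵐ` that have an inverse morphism. -/
def automorphisms (K : Type*) [Field K] (m : ℕ) : Set (RationalMap K m m) :=
  {φ | φ.IsMorphism ∧ ∃ ψ : RationalMap K m m, ψ.IsMorphism ∧
    IsComp φ ψ (identity K m) ∧ IsComp ψ φ (identity K m)}

end RationalMap

end ProjectiveMaps

/-! Write $f=(F_0:\dots:F_M)$ in lowest terms, of degree $d$. A morphism has no common zero among
its reduced coordinates, and $d>0$ because $f$ is not constant.

Symmetries are linear. If $f\circ\varphi=f$ and $\Phi$ is a reduced tuple for $\varphi$, then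
$F\circ\Phi=tF$ for a polynomial $t$. On the zeros of a prime factor $p$ of $t$ one has
$F(\Phi(x))=0$, so $\Phi(x)=0$, and by the Nullstellensatz $p$ divides every $\Phi_j$, which is
absurd. So $t$ is constant, $d\deg\Phi=d$, and $\Phi$ is a tuple of linear forms without common
zero, i.e. an invertible matrix (`IsComp.exists_eq_C_mul`, `IsComp.exists_ofGL`). Thus $\Gamma_f$ is
the image in PGL of the group of matrices preserving $F$ up to a constant.

The bound (`FormTuple.card_le_degree_pow`). The polynomial ring is finite over $K[F_0,\dots,F_M]$,
so $m+1$ of the $F_j$ are algebraically independent. Given $N$ distinct symmetries $A_i$, choose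
forms $h_j$ of degree $N-1$ with $\det(h_j\circ A_i)\ne0$. Applying every $A_i$ to a relation
$\sum_j h_jp_j(F)=0$, with all $p_j$ forms of degree $k$ in the independent $F_j$, gives $p_j=0$.
Hence $N\binom{k+m}{m}\le\binom{dk+N-1+m}{m}$ for all $k$, so $N\le d^m\le d^M$.

The critical locus is preserved by the chain rule: composing with an invertible matrix does not
change the rank of the differential. -/

namespace MvPolynomial

/-! ### Forms, their factors and substitution into them -/

section Homogeneous

variable {σ R : Type*} [CommRing R]

/-- The homomorphism that records the homogeneous components of a polynomial as the coefficients
of a polynomial in one further variable. -/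
noncomputable def gradingHom (σ R : Type*) [CommRing R] :
    MvPolynomial σ R →ₐ[R] Polynomial (MvPolynomial σ R) :=
  aeval fun i => Polynomial.C (X i) * Polynomial.X

theorem gradingHom_monomial (s : σ →₀ ℕ) (r : R) :
    gradingHom σ R (monomial s r) = Polynomial.monomial s.degree (monomial s r) := by
  rw [gradingHom, aeval_monomial, monomial_eq, Polynomial.algebraMap_apply, algebraMap_eq,
    Finsupp.prod, Finsupp.prod, Finsupp.degree_apply]
  simp only [mul_pow, Finset.prod_mul_distrib, Finset.prod_pow_eq_pow_sum, ← map_pow, ← map_prod]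
  rw [← mul_assoc, ← map_mul, Polynomial.C_mul_X_pow_eq_monomial]

theorem coeff_gradingHom (p : MvPolynomial σ R) (n : ℕ) :
    (gradingHom σ R p).coeff n = homogeneousComponent n p := by
  induction p using MvPolynomial.induction_on' with
  | monomial s r =>
    rw [gradingHom_monomial, Polynomial.coeff_monomial]
    rw [homogeneousComponent_of_mem (m := n) (isHomogeneous_monomial r rfl)]
    simp only [eq_comm]
  | add p q hp hq => rw [map_add, Polynomial.coeff_add, hp, hq, map_add]

theorem gradingHom_ne_zero {p : MvPolynomial σ R} (hp : p ≠ 0) : gradingHom σ R p ≠ 0 := by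
  intro h
  apply hp
  rw [← sum_homogeneousComponent p]
  refine Finset.sum_eq_zero fun i _ => ?_
  rw [← coeff_gradingHom, h, Polynomial.coeff_zero]

theorem IsHomogeneous.gradingHom_eq {p : MvPolynomial σ R} {n : ℕ} (hp : p.IsHomogeneous n) :
    gradingHom σ R p = Polynomial.monomial n p := by
  ext1 k
  rw [coeff_gradingHom, Polynomial.coeff_monomial, homogeneousComponent_of_mem hp]
  simp only [eq_comm]

/-- When the top and bottom degrees agree, only one homogeneous component survives. -/
theorem isHomogeneous_of_natDegree_le {p : MvPolynomial σ R}
    (h : (gradingHom σ R p).natDegree ≤ (gradingHom σ R p).natTrailingDegree) :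
    p.IsHomogeneous (gradingHom σ R p).natDegree := by
  have : p = homogeneousComponent (gradingHom σ R p).natDegree p := by
    conv_lhs => rw [← sum_homogeneousComponent p]
    refine Finset.sum_eq_single_of_mem _ ?_ ?_
    · rw [Finset.mem_range, Nat.lt_succ_iff, Polynomial.natDegree_le_iff_coeff_eq_zero]
      intro k hk
      rw [coeff_gradingHom, homogeneousComponent_eq_zero _ _ hk]
    · intro k _ hk
      rw [← coeff_gradingHom]
      rcases lt_or_gt_of_ne hk with hk | hk
      · exact Polynomial.coeff_eq_zero_of_lt_natTrailingDegree (hk.trans_le h)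
      · exact Polynomial.coeff_eq_zero_of_natDegree_lt hk
  rw [this]
  convert homogeneousComponent_isHomogeneous _ _
  exact this.symm

/-- The factors of a nonzero form over a domain are forms. -/
theorem IsHomogeneous.exists_of_mul [IsDomain R] {p q : MvPolynomial σ R} {n : ℕ}
    (h : (p * q).IsHomogeneous n) (hpq : p * q ≠ 0) :
    ∃ a b, a + b = n ∧ p.IsHomogeneous a ∧ q.IsHomogeneous b := by
  have hp := gradingHom_ne_zero (left_ne_zero_of_mul hpq)
  have hq := gradingHom_ne_zero (right_ne_zero_of_mul hpq)
  -- Over a domain both degree and trailing degree are additive. They agree for the product, hence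
  -- for each factor.
  have hm := h.gradingHom_eq
  rw [map_mul] at hm
  have h₁ := Polynomial.natDegree_mul hp hq
  have h₂ := Polynomial.natTrailingDegree_mul hp hq
  rw [hm, Polynomial.natDegree_monomial_eq _ hpq] at h₁
  rw [hm, Polynomial.natTrailingDegree_monomial hpq] at h₂
  have h₃ := Polynomial.natTrailingDegree_le_natDegree (gradingHom σ R p)
  have h₄ := Polynomial.natTrailingDegree_le_natDegree (gradingHom σ R q)
  exact ⟨_, _, h₁.symm, isHomogeneous_of_natDegree_le (by omega),
    isHomogeneous_of_natDegree_le (by omega)⟩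

/-- Substituting proportional arguments into a form. -/
theorem IsHomogeneous.aeval_mul {S : Type*} [CommRing S] [Algebra R S] {p : MvPolynomial σ R}
    {n : ℕ} (hp : p.IsHomogeneous n) (c : S) (g : σ → S) :
    MvPolynomial.aeval (fun i => c * g i) p = c ^ n * MvPolynomial.aeval g p := by
  rw [aeval_def, aeval_def, eval₂_eq, eval₂_eq, Finset.mul_sum]
  refine Finset.sum_congr rfl fun s hs => ?_
  have hd : s.degree = n := by
    by_contra hne
    exact (mem_support_iff.1 hs) (hp.coeff_eq_zero hne)
  simp only [mul_pow, Finset.prod_mul_distrib, Finset.prod_pow_eq_pow_sum]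
  rw [← hd, Finsupp.degree_apply]
  ring

theorem IsHomogeneous.eval_smul {p : MvPolynomial σ R} {n : ℕ} (hp : p.IsHomogeneous n)
    (c : R) (x : σ → R) : eval (c • x) p = c ^ n * eval x p := by
  have := hp.aeval_mul c x
  rwa [aeval_eq_eval, aeval_eq_eval] at this

theorem IsHomogeneous.eval_zero {p : MvPolynomial σ R} {n : ℕ} (hp : p.IsHomogeneous n)
    (hn : n ≠ 0) : eval (0 : σ → R) p = 0 := by
  have := hp.eval_smul 0 0
  rwa [zero_smul, zero_pow hn, zero_mul] at this

theorem IsHomogeneous.eq_sum_X [Fintype σ] {p : MvPolynomial σ R} (hp : p.IsHomogeneous 1) :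
    p = ∑ j, C (coeff (Finsupp.single j 1) p) * X j := by
  classical
  have hs : p ∈ Submodule.span R (Set.range (X : σ → MvPolynomial σ R)) := by
    rw [← homogeneousSubmodule_one_eq_span_X]
    exact hp
  obtain ⟨c, rfl⟩ := (Submodule.mem_span_range_iff_exists_fun R).1 hs
  refine Finset.sum_congr rfl fun j _ => ?_
  rw [smul_eq_C_mul]
  congr 2
  rw [coeff_sum, Finset.sum_eq_single j]
  · simp
  · intro b _ hb
    rw [coeff_smul, coeff_X, if_neg, smul_zero]
    intro h
    exact hb ((Finsupp.single_left_inj one_ne_zero).1 h)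
  · simp

end Homogeneous

section Nullstellensatz

variable {σ K : Type*} [Field K] [IsAlgClosed K] [Finite σ]

/-- A polynomial that vanishes on the zeros of a prime polynomial is a multiple of it. -/
theorem dvd_of_forall_eval_eq_zero {p q : MvPolynomial σ K} (hp : Prime p)
    (h : ∀ x, eval x p = 0 → eval x q = 0) : p ∣ q := by
  have hprime : (Ideal.span {p}).IsPrime := (Ideal.span_singleton_prime hp.ne_zero).2 hp
  rw [← Ideal.mem_span_singleton, ← hprime.radical,
    ← vanishingIdeal_zeroLocus_eq_radical (k := K) (K := K), mem_vanishingIdeal_iff]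
  intro x hx
  rw [mem_zeroLocus_iff] at hx
  have := hx p (Ideal.mem_span_singleton_self p)
  rw [aeval_eq_eval] at this ⊢
  exact h x this

end Nullstellensatz

end MvPolynomial

/-- A cancellation rule for a family without common prime factor. -/
theorem dvd_of_forall_dvd_mul_of_coprime {R ι : Type*} [CommRing R] [IsDomain R]
    [UniqueFactorizationMonoid R] {φ : ι → R} (hφ : ∀ p, Prime p → ∃ j, ¬ p ∣ φ j) {a : R}
    (ha : a ≠ 0) : ∀ b, (∀ j, a ∣ φ j * b) → a ∣ b := by
  induction a using UniqueFactorizationMonoid.induction_on_prime with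
  | h₁ => exact absurd rfl ha
  | h₂ u hu => exact fun b _ => hu.dvd
  | h₃ a p ha0 hp ih =>
    intro b hb
    -- Some `φ j` is prime to `p`, so `p` divides `b` and can be cancelled throughout.
    obtain ⟨j, hj⟩ := hφ p hp
    obtain ⟨b, rfl⟩ := (hp.dvd_or_dvd ((dvd_mul_right p a).trans (hb j))).resolve_left hj
    refine mul_dvd_mul_left p (ih ha0 b fun j => ?_)
    refine (mul_dvd_mul_iff_left hp.ne_zero).1 ?_
    rw [mul_left_comm]
    exact hb j

/-! ### Rational maps in lowest terms -/

namespace ProjectiveMaps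

variable {K : Type*} [Field K] {m n l : ℕ}

namespace FormTuple

/-- The forms have no common factor. -/
def IsCoprime (Φ : FormTuple K m n) : Prop := ∀ p, Prime p → ∃ j, ¬ p ∣ Φ.forms j

/-- The forms have no common zero, except possibly the origin. -/
def NoCommonZero (Φ : FormTuple K m n) : Prop := ∀ x, Φ.eval x = 0 → x = 0

theorem eval_smul (Φ : FormTuple K m n) (c : K) (x : Fin (m + 1) → K) :
    Φ.eval (c • x) = c ^ Φ.degree • Φ.eval x := by
  funext j
  exact (Φ.homogeneous j).eval_smul c x

theorem eval_zero (Φ : FormTuple K m n) (h : Φ.degree ≠ 0) : Φ.eval 0 = 0 := by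
  funext j
  exact (Φ.homogeneous j).eval_zero h

theorem eval_ofGL (A : GL (Fin (m + 1)) K) (x : Fin (m + 1) → K) :
    (ofGL A).eval x = A.val.mulVec x := by
  funext i
  simp [FormTuple.eval, ofGL, Matrix.mulVec, dotProduct]

theorem eval_bind₁_forms (Ψ : FormTuple K n l) (Φ : FormTuple K m n) (x : Fin (m + 1) → K)
    (j : Fin (l + 1)) :
    MvPolynomial.eval x (bind₁ Φ.forms (Ψ.forms j)) = Ψ.eval (Φ.eval x) j := by
  rw [← aeval_eq_eval, aeval_bind₁]
  rfl

theorem ofGL_one_forms (i : Fin (m + 1)) : (ofGL (1 : GL (Fin (m + 1)) K)).forms i = X i := by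
  simp [ofGL, Matrix.one_apply]

/-- The substitution of `Φ` into forms, where the result does not vanish identically. -/
noncomputable def comp (Ψ : FormTuple K n l) (Φ : FormTuple K m n)
    (h : ∃ j, bind₁ Φ.forms (Ψ.forms j) ≠ 0) : FormTuple K m l where
  forms j := bind₁ Φ.forms (Ψ.forms j)
  degree := Φ.degree * Ψ.degree
  homogeneous j := (Ψ.homogeneous j).aeval _ Φ.homogeneous
  ne_zero := h

/-- Proportional tuples, the first of them without common factor. -/
theorem IsCoprime.exists_eq_mul {Φ Ψ : FormTuple K m n} (hΦ : Φ.IsCoprime) (h : Φ ≈ Ψ) :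
    ∃ H, H ≠ 0 ∧ ∀ j, Ψ.forms j = H * Φ.forms j := by
  obtain ⟨k, hk⟩ := Φ.ne_zero
  obtain ⟨H, hH⟩ := dvd_of_forall_dvd_mul_of_coprime hΦ hk (Ψ.forms k)
    fun j => Dvd.intro _ (h k j)
  have key : ∀ j, Ψ.forms j = H * Φ.forms j := fun j => by
    refine mul_left_cancel₀ hk ?_
    rw [h k j, hH]
    ring
  refine ⟨H, ?_, key⟩
  rintro rfl
  obtain ⟨j, hj⟩ := Ψ.ne_zero
  exact hj (by rw [key, zero_mul])

/-- A common prime factor is itself a form, of positive degree, and can be divided out. -/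
theorem exists_degree_lt_of_not_isCoprime {Φ : FormTuple K m n} (h : ¬ Φ.IsCoprime) :
    ∃ Ψ : FormTuple K m n, Ψ ≈ Φ ∧ Ψ.degree < Φ.degree := by
  simp only [IsCoprime, not_forall, not_exists, not_not] at h
  obtain ⟨p, hp, hdvd⟩ := h
  choose q hq using hdvd
  obtain ⟨k, hk⟩ := Φ.ne_zero
  obtain ⟨a, b, hab, ha, -⟩ := IsHomogeneous.exists_of_mul (hq k ▸ Φ.homogeneous k) (hq k ▸ hk)
  have ha0 : a ≠ 0 := by
    rintro rfl
    refine hp.not_isUnit ?_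
    rw [← totalDegree_zero_iff_isHomogeneous, totalDegree_eq_zero_iff_eq_C] at ha
    rw [ha]
    refine IsUnit.map C (isUnit_iff_ne_zero.2 fun h0 => hp.ne_zero ?_)
    rw [ha, h0, map_zero]
  refine ⟨⟨q, b, fun j => ?_, k, fun h0 => hk (by rw [hq, h0, mul_zero])⟩, fun i j => ?_, ?_⟩
  · by_cases hj : q j = 0
    · rw [hj]
      exact isHomogeneous_zero _ _ _
    · have hne : p * q j ≠ 0 := mul_ne_zero hp.ne_zero hj
      obtain ⟨a₁, b₁, hab₁, ha₁, hb₁⟩ := IsHomogeneous.exists_of_mul (hq j ▸ Φ.homogeneous j) hne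
      have := ha.inj_right ha₁ hp.ne_zero
      obtain rfl : b = b₁ := by omega
      exact hb₁
  · simp only [hq]
    ring
  · change b < Φ.degree
    omega

/-- The coordinates of a projective space of positive dimension have no common factor. -/
theorem isCoprime_ofGL_one (hm : m ≠ 0) : (ofGL (1 : GL (Fin (m + 1)) K)).IsCoprime := by
  intro p hp
  by_contra! h
  simp only [ofGL_one_forms] at h
  have h01 : (0 : Fin (m + 1)) ≠ Fin.last m := by
    intro h
    exact hm (congrArg Fin.val h).symm
  have hass := hp.associated_of_dvd (X_prime (R := K) (i := (0 : Fin (m + 1)))) (h 0)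
  have hd : (X 0 : MvPolynomial (Fin (m + 1)) K) ∣ X (Fin.last m) := hass.symm.dvd.trans (h _)
  rw [X_dvd_X] at hd
  exact h01 hd

end FormTuple

namespace RationalMap

theorem exists_represents (f : RationalMap K m n) : ∃ Φ, Represents Φ f :=
  Quotient.exists_rep f

theorem Represents.equiv {f : RationalMap K m n} {Φ Ψ : FormTuple K m n} (hΦ : Represents Φ f)
    (hΨ : Represents Ψ f) : Φ ≈ Ψ :=
  Quotient.exact (hΦ.trans hΨ.symm)

theorem Represents.of_equiv {f : RationalMap K m n} {Φ Ψ : FormTuple K m n} (hΦ : Represents Φ f)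
    (h : Ψ ≈ Φ) : Represents Ψ f :=
  (Quotient.sound h).trans hΦ

/-- Every rational map has homogeneous coordinates in lowest terms. -/
theorem exists_isCoprime (f : RationalMap K m n) :
    ∃ Φ, Represents Φ f ∧ Φ.IsCoprime ∧ Φ.degree = f.degree := by
  obtain ⟨Φ₀, h₀⟩ := f.exists_represents
  obtain ⟨Φ, hΦ, hd⟩ := Nat.sInf_mem (s := {d | ∃ Φ : FormTuple K m n, Represents Φ f ∧
    Φ.degree = d}) ⟨_, Φ₀, h₀, rfl⟩
  refine ⟨Φ, hΦ, ?_, hd⟩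
  by_contra hc
  obtain ⟨Ψ, hΨ, hlt⟩ := FormTuple.exists_degree_lt_of_not_isCoprime hc
  have : f.degree ≤ Ψ.degree := Nat.sInf_le ⟨Ψ, hΦ.of_equiv hΨ, rfl⟩
  change Φ.degree = f.degree at hd
  omega

/-- The homogeneous coordinates in lowest terms of a morphism have no common zero. -/
theorem IsMorphism.noCommonZero {f : RationalMap K m n} (hf : f.IsMorphism)
    {Φ : FormTuple K m n} (hΦ : Represents Φ f) (hc : Φ.IsCoprime) : Φ.NoCommonZero := by
  intro x h0
  by_contra hx
  have hP : Projectivization.mk K x hx ∈ f.domain := hf ▸ Set.mem_univ _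
  obtain ⟨Q, Ψ, y, hy, hne, hΨ, hxy, -⟩ := hP
  obtain ⟨a, rfl⟩ := (Projectivization.mk_eq_mk_iff' _ _ _ _ _).1 hxy
  -- The tuple witnessing that `f` is defined at the point is a multiple of `Φ`, so it would vanish
  -- there too.
  obtain ⟨H, -, hH⟩ := hc.exists_eq_mul (hΦ.equiv hΨ)
  rw [FormTuple.eval_smul] at h0
  have ha : a ≠ 0 := by
    rintro rfl
    exact hx (zero_smul _ _)
  have h1 := (smul_eq_zero.1 h0).resolve_left (pow_ne_zero _ ha)
  apply hne
  funext j
  have := congrFun h1 j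
  simp only [FormTuple.eval, Pi.zero_apply] at this ⊢
  rw [hH, map_mul, this, mul_zero]

theorem mapsPoint_of_eval_ne_zero {f : RationalMap K m n} {Φ : FormTuple K m n}
    (hΦ : Represents Φ f) {x : Fin (m + 1) → K} (hx : x ≠ 0) (h : Φ.eval x ≠ 0) :
    f.MapsPoint (Projectivization.mk K x hx) (Projectivization.mk K (Φ.eval x) h) :=
  ⟨Φ, x, hx, h, hΦ, rfl, rfl⟩

theorem degree_ne_zero_of_not_isConstant {f : RationalMap K m n} (hf : ¬ f.IsConstant)
    {Φ : FormTuple K m n} (hΦ : Represents Φ f) : Φ.degree ≠ 0 := by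
  intro hd
  apply hf
  have hC : ∀ j, Φ.forms j = C (coeff 0 (Φ.forms j)) := fun j => by
    rw [← totalDegree_eq_zero_iff_eq_C, totalDegree_zero_iff_isHomogeneous, ← hd]
    exact Φ.homogeneous j
  have he : ∀ x, Φ.eval x = fun j => coeff 0 (Φ.forms j) := fun x => by
    funext j
    rw [FormTuple.eval, hC, eval_C, coeff_zero_C]
  have hne : ∀ x, Φ.eval x ≠ 0 := fun x h => by
    obtain ⟨k, hk⟩ := Φ.ne_zero
    rw [he] at h
    exact hk (by rw [hC, congrFun h k, Pi.zero_apply, map_zero])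
  refine ⟨Projectivization.mk K _ (hne 0), fun P _ => ?_⟩
  induction P using Projectivization.ind with
  | h x hx => exact ⟨Φ, x, hx, hne x, hΦ, rfl, by simp only [he]⟩

/-- If `g ∘ f = h` and the homogeneous coordinates of `g` have no common zero, then in lowest
terms the homogeneous coordinates of `h` are obtained by substitution, up to a constant. -/
theorem IsComp.exists_eq_C_mul [IsAlgClosed K] {g : RationalMap K n l} {f : RationalMap K m n}
    {h : RationalMap K m l} (hc : IsComp g f h) {G : FormTuple K n l} {F : FormTuple K m n}
    {H : FormTuple K m l} (hG : Represents G g) (hF : Represents F f) (hH : Represents H h)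
    (cG : G.IsCoprime) (cF : F.IsCoprime) (cH : H.IsCoprime) (zG : G.NoCommonZero) :
    F.degree * G.degree = H.degree ∧
      ∃ c : K, c ≠ 0 ∧ ∀ j, bind₁ F.forms (G.forms j) = C c * H.forms j := by
  obtain ⟨Ψ, Φ, Θ, hΨ, hΦ, hΘ, hcomp⟩ := hc
  obtain ⟨a, -, ha⟩ := cG.exists_eq_mul (hG.equiv hΨ)
  obtain ⟨b, -, hb⟩ := cF.exists_eq_mul (hF.equiv hΦ)
  -- The composition is given on arbitrary representatives; their extra factors `a` and `b` come out
  -- as one common factor.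
  have key : ∀ j, Θ.forms j = (bind₁ Φ.forms a * b ^ G.degree) * bind₁ F.forms (G.forms j) := by
    intro j
    rw [hcomp, ha, map_mul, funext hb, mul_assoc]
    congr 1
    exact (G.homogeneous j).aeval_mul b F.forms
  obtain ⟨k, hk⟩ := Θ.ne_zero
  rw [key] at hk
  have hne : ∃ j, bind₁ F.forms (G.forms j) ≠ 0 := ⟨k, right_ne_zero_of_mul hk⟩
  have hequiv : H ≈ G.comp F hne := by
    refine Setoid.trans (hH.equiv hΘ) fun i j => ?_
    simp only [key, FormTuple.comp]
    ring
  obtain ⟨t, ht, hmul⟩ := cH.exists_eq_mul hequiv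
  -- Where a prime factor of `t` vanishes, so does `G ∘ F`, hence `F`; the factor would then divide
  -- all of `F`.
  have hunit : IsUnit t := by
    by_contra hu
    obtain ⟨p, hp, hpt⟩ := WfDvdMonoid.exists_irreducible_factor hu ht
    obtain ⟨j, hj⟩ := cF p hp.prime
    refine hj (dvd_of_forall_eval_eq_zero hp.prime fun x hx => ?_)
    refine congrFun (zG (F.eval x) ?_) j
    funext i
    have := congrArg (eval x) (hmul i)
    obtain ⟨s, rfl⟩ := hpt
    simp only [FormTuple.comp, map_mul, hx, zero_mul] at this
    rwa [FormTuple.eval_bind₁_forms] at this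
  obtain ⟨c, hc, rfl⟩ := MvPolynomial.isUnit_iff_eq_C_of_isReduced.1 hunit
  refine ⟨?_, c, hc.ne_zero, hmul⟩
  obtain ⟨i, hi⟩ := H.ne_zero
  have hi' := (G.comp F hne).homogeneous i
  rw [hmul] at hi'
  exact hi'.inj_right ((H.homogeneous i).C_mul c) (mul_ne_zero ht hi)

end RationalMap
end ProjectiveMaps

/-! ### Projective transformations and automorphisms -/

namespace ProjectiveMaps

variable {K : Type*} [Field K] {m n l : ℕ}

namespace FormTuple

theorem bind₁_ofGL_forms (A B : GL (Fin (m + 1)) K) (i : Fin (m + 1)) :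
    bind₁ (ofGL B).forms ((ofGL A).forms i) = (ofGL (A * B)).forms i := by
  simp only [ofGL, map_sum, map_mul, bind₁_C_right, bind₁_X_right, Units.val_mul,
    Matrix.mul_apply, Finset.mul_sum, Finset.sum_mul]
  rw [Finset.sum_comm]
  simp only [mul_assoc]

theorem bind₁_ofGL_mul (A B : GL (Fin (m + 1)) K) (p : MvPolynomial (Fin (m + 1)) K) :
    bind₁ (ofGL (A * B)).forms p = bind₁ (ofGL B).forms (bind₁ (ofGL A).forms p) := by
  rw [bind₁_bind₁]
  congr 2
  funext i
  exact (bind₁_ofGL_forms A B i).symm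

theorem bind₁_ofGL_one (p : MvPolynomial (Fin (m + 1)) K) :
    bind₁ (ofGL (1 : GL (Fin (m + 1)) K)).forms p = p := by
  rw [funext ofGL_one_forms]
  exact aeval_X_left_apply p

theorem bind₁_ofGL_inv_bind₁ (A : GL (Fin (m + 1)) K) (p : MvPolynomial (Fin (m + 1)) K) :
    bind₁ (ofGL A⁻¹).forms (bind₁ (ofGL A).forms p) = p := by
  rw [← bind₁_ofGL_mul, mul_inv_cancel, bind₁_ofGL_one]

theorem bind₁_ofGL_ne_zero (A : GL (Fin (m + 1)) K) {p : MvPolynomial (Fin (m + 1)) K}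
    (hp : p ≠ 0) : bind₁ (ofGL A).forms p ≠ 0 := by
  intro h
  apply hp
  rw [← bind₁_ofGL_inv_bind₁ A p, h, map_zero]

/-- The tuple `Φ ∘ A` for an invertible matrix `A`. -/
noncomputable def compGL (Φ : FormTuple K m n) (A : GL (Fin (m + 1)) K) : FormTuple K m n :=
  Φ.comp (ofGL A) (Φ.ne_zero.imp fun _ h => bind₁_ofGL_ne_zero A h)

theorem eval_compGL (Φ : FormTuple K m n) (A : GL (Fin (m + 1)) K) (x : Fin (m + 1) → K) :
    (Φ.compGL A).eval x = Φ.eval (A.val.mulVec x) := by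
  rw [← eval_ofGL]
  funext j
  exact eval_bind₁_forms Φ (ofGL A) x j

theorem mulVec_ne_zero (A : GL (Fin (m + 1)) K) {x : Fin (m + 1) → K} (hx : x ≠ 0) :
    A.val.mulVec x ≠ 0 := by
  intro h
  apply hx
  have := congrArg (A⁻¹.val.mulVec) h
  rwa [Matrix.mulVec_mulVec, Matrix.mulVec_zero, ← Units.val_mul, inv_mul_cancel, Units.val_one,
    Matrix.one_mulVec] at this

theorem noCommonZero_ofGL (A : GL (Fin (m + 1)) K) : (ofGL A).NoCommonZero := by
  intro x h
  by_contra hx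
  rw [eval_ofGL] at h
  exact mulVec_ne_zero A hx h

/-- Linear forms without common zero are given by an invertible matrix. -/
theorem exists_eq_ofGL {Φ : FormTuple K m m} (hd : Φ.degree = 1) (hz : Φ.NoCommonZero) :
    ∃ A, Φ = ofGL A := by
  let B : Matrix (Fin (m + 1)) (Fin (m + 1)) K :=
    Matrix.of fun i j => coeff (Finsupp.single j 1) (Φ.forms i)
  have hB : ∀ i, Φ.forms i = ∑ j, C (B i j) * X j := fun i =>
    IsHomogeneous.eq_sum_X (by simpa only [hd] using Φ.homogeneous i)
  have hinj : Function.Injective B.mulVec := by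
    rw [← Matrix.coe_mulVecLin, injective_iff_map_eq_zero]
    intro x hx
    refine hz x ?_
    rw [← hx]
    funext i
    simp [FormTuple.eval, hB, Matrix.mulVec, dotProduct]
  have hu : IsUnit B := Matrix.mulVec_injective_iff_isUnit.1 hinj
  refine ⟨hu.unit, ?_⟩
  have hforms : Φ.forms = (ofGL hu.unit).forms := funext hB
  obtain ⟨φ, d, hom, ne⟩ := Φ
  simp only [ofGL, mk.injEq]
  exact ⟨hforms, hd⟩

end FormTuple

namespace RationalMap

theorem represents_ofGL (A : GL (Fin (m + 1)) K) :
    Represents (FormTuple.ofGL A) (ofPGL (Matrix.ProjGenLinGroup.mk A)) :=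
  rfl

theorem represents_identity : Represents (FormTuple.ofGL 1) (identity K m) :=
  rfl

theorem ofPGL_one : ofPGL 1 = identity K m :=
  rfl

theorem isComp_ofPGL (g h : PGL(Fin (m + 1), K)) : IsComp (ofPGL g) (ofPGL h) (ofPGL (g * h)) := by
  obtain ⟨A, rfl⟩ := Matrix.ProjGenLinGroup.mk_surjective g
  obtain ⟨B, rfl⟩ := Matrix.ProjGenLinGroup.mk_surjective h
  rw [← map_mul]
  exact ⟨_, _, _, represents_ofGL A, represents_ofGL B, represents_ofGL (A * B),
    fun j => (FormTuple.bind₁_ofGL_forms A B j).symm⟩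

/-- The matrix $D=BA^{-1}$ maps every vector to a multiple of itself. Testing on $e_i$ makes $D$
diagonal, and on $e_i+e_0$ scalar. -/
theorem mk_eq_mk_of_equiv {A B : GL (Fin (m + 1)) K}
    (h : FormTuple.ofGL A ≈ FormTuple.ofGL B) :
    Matrix.ProjGenLinGroup.mk A = Matrix.ProjGenLinGroup.mk B := by
  set D : Matrix (Fin (m + 1)) (Fin (m + 1)) K := (B * A⁻¹).val with hD
  have key : ∀ (y : Fin (m + 1) → K) (i j), y i * D.mulVec y j = y j * D.mulVec y i := by
    intro y i j
    have hA : A.val.mulVec (A⁻¹.val.mulVec y) = y := by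
      rw [Matrix.mulVec_mulVec, ← Units.val_mul, mul_inv_cancel, Units.val_one,
        Matrix.one_mulVec]
    have hB : B.val.mulVec (A⁻¹.val.mulVec y) = D.mulVec y := by
      rw [Matrix.mulVec_mulVec, ← Units.val_mul]
    have hij := congrArg (eval (A⁻¹.val.mulVec y)) (h i j)
    have e : ∀ (E : GL (Fin (m + 1)) K) x k,
        eval x ((FormTuple.ofGL E).forms k) = E.val.mulVec x k :=
      fun E x k => congrFun (FormTuple.eval_ofGL E x) k
    simpa only [map_mul, e, hA, hB] using hij
  have hoff : ∀ i j, i ≠ j → D j i = 0 := by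
    intro i j hij
    simpa [hij.symm] using key (Pi.single i 1) i j
  have hdiag : ∀ i, D i i = D 0 0 := by
    intro i
    by_cases hi : i = 0
    · rw [hi]
    · have := key (Pi.single i 1 + Pi.single 0 1) i 0
      simpa [Matrix.mulVec_add, hi, Ne.symm hi, hoff i 0 hi, hoff 0 i (Ne.symm hi), eq_comm]
        using this
  have hDs : D = Matrix.scalar _ (D 0 0) := by
    ext i j
    by_cases hij : i = j
    · rw [hij, hdiag]
      simp
    · simp [hij, hoff j i (Ne.symm hij)]
  have hu : D 0 0 ≠ 0 := by
    intro h0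
    rw [h0, map_zero] at hDs
    exact (B * A⁻¹).ne_zero hDs
  refine Matrix.ProjGenLinGroup.mk_eq_mk_iff.2 ⟨Units.mk0 _ hu, ?_⟩
  have hs : B * A⁻¹ = .scalar (Fin (m + 1)) (Units.mk0 _ hu) := Units.ext hDs
  have hcen : .scalar (Fin (m + 1)) (Units.mk0 _ hu) ∈ Subgroup.center (GL (Fin (m + 1)) K) := by
    rw [Matrix.GeneralLinearGroup.center_eq_range_scalar]
    exact ⟨_, rfl⟩
  rw [Subgroup.mem_center_iff.1 hcen A, ← hs, inv_mul_cancel_right]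

theorem ofPGL_injective : Function.Injective (ofPGL (K := K) (m := m)) := by
  intro g h hgh
  obtain ⟨A, rfl⟩ := Matrix.ProjGenLinGroup.mk_surjective g
  obtain ⟨B, rfl⟩ := Matrix.ProjGenLinGroup.mk_surjective h
  exact mk_eq_mk_of_equiv ((represents_ofGL A).equiv (hgh ▸ represents_ofGL B))

theorem isMorphism_ofPGL (g : PGL(Fin (m + 1), K)) : (ofPGL g).IsMorphism := by
  obtain ⟨A, rfl⟩ := Matrix.ProjGenLinGroup.mk_surjective g
  refine Set.eq_univ_of_forall fun P => ?_
  induction P using Projectivization.ind with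
  | h x hx =>
    exact ⟨_, mapsPoint_of_eval_ne_zero (represents_ofGL A) hx
      fun h => hx (FormTuple.noCommonZero_ofGL A x h)⟩

/-- If `g ∘ f = h` for morphisms `g` and `h`, where `g` is not of degree zero and the degrees force
`f` to be of degree one, then `f` is a projective transformation. -/
theorem IsComp.exists_ofGL [IsAlgClosed K] {g : RationalMap K m n} {f : RationalMap K m m}
    {h : RationalMap K m n} (hc : IsComp g f h) {G : FormTuple K m n}
    {H : FormTuple K m n} (hG : Represents G g) (hH : Represents H h)
    (cG : G.IsCoprime) (cH : H.IsCoprime) (zG : G.NoCommonZero) (zH : H.NoCommonZero)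
    (hd : f.degree * G.degree = H.degree → f.degree = 1) (h0 : G.degree ≠ 0) :
    ∃ A, Represents (FormTuple.ofGL A) f ∧ ∃ c : K, c ≠ 0 ∧
      ∀ j, bind₁ (FormTuple.ofGL A).forms (G.forms j) = C c * H.forms j := by
  obtain ⟨F, hF, cF, hFd⟩ := f.exists_isCoprime
  obtain ⟨h1, c, hc, key⟩ := hc.exists_eq_C_mul hG hF hH cG cF cH zG
  have hF1 : F.degree = 1 := hFd ▸ hd (hFd ▸ h1)
  -- As `G` has positive degree, a zero of `F` is a zero of `G ∘ F`, so of `H`.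
  have zF : F.NoCommonZero := by
    intro x hx
    refine zH x ?_
    funext j
    have := congrArg (eval x) (key j)
    rw [FormTuple.eval_bind₁_forms, hx, G.eval_zero h0, map_mul, eval_C, Pi.zero_apply] at this
    exact (mul_eq_zero.1 this.symm).resolve_left hc
  obtain ⟨A, rfl⟩ := FormTuple.exists_eq_ofGL hF1 zF
  exact ⟨A, hF, c, hc, key⟩

/-- For surjectivity, $\psi\circ\varphi=\mathrm{id}$ makes the two degrees multiply to 1. On
$\mathbb{P}^0$ the coordinate $X_0$ is a common factor of the identity tuple, so the degree argument
needs $m\ne0$. -/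
theorem bijOn_ofPGL [IsAlgClosed K] (hm : m ≠ 0) :
    Set.BijOn (ofPGL (K := K) (m := m)) Set.univ (automorphisms K m) := by
  refine ⟨fun g _ => ?_, ofPGL_injective.injOn, ?_⟩
  · refine ⟨isMorphism_ofPGL g, ofPGL g⁻¹, isMorphism_ofPGL _, ?_, ?_⟩
    · simpa only [mul_inv_cancel, ofPGL_one] using isComp_ofPGL g g⁻¹
    · simpa only [inv_mul_cancel, ofPGL_one] using isComp_ofPGL g⁻¹ g
  · rintro φ ⟨-, ψ, hψ, -, hc⟩
    obtain ⟨G, hG, cG, hGd⟩ := ψ.exists_isCoprime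
    have h1 := FormTuple.isCoprime_ofGL_one (K := K) hm
    have hG0 : G.degree ≠ 0 := by
      intro h0
      obtain ⟨F, hF, cF, hFd⟩ := φ.exists_isCoprime
      have hdeg := (hc.exists_eq_C_mul hG hF represents_identity cG cF h1
        (hψ.noCommonZero hG cG)).1
      rw [h0, mul_zero] at hdeg
      exact zero_ne_one hdeg
    obtain ⟨A, hA, -⟩ := hc.exists_ofGL hG represents_identity cG h1 (hψ.noCommonZero hG cG)
      (FormTuple.noCommonZero_ofGL 1) (fun h => Nat.eq_one_of_mul_eq_one_right h) hG0
    exact ⟨Matrix.ProjGenLinGroup.mk A, Set.mem_univ _, hA⟩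

end RationalMap
end ProjectiveMaps

/-! ### Forms without common zero: finiteness and algebraic independence -/

namespace MvPolynomial

/-- The dimension of the space of forms of a given degree. -/
theorem finrank_homogeneousSubmodule (K : Type*) [Field K] (m k : ℕ) :
    Module.finrank K (homogeneousSubmodule (Fin (m + 1)) K k) = (k + m).choose m := by
  have hset : {s : Fin (m + 1) →₀ ℕ | s.degree = k} =
      (Finset.univ.finsuppAntidiag k : Finset (Fin (m + 1) →₀ ℕ)) := by
    ext s
    simp [Finsupp.degree_eq_sum]
  rw [homogeneousSubmodule_eq_finsupp_supported, hset,
    (AddMonoidAlgebra.supportedEquivFinsupp _).finrank_eq, Module.finrank_finsupp_self]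
  simp only [Finset.coe_sort_coe, Fintype.card_coe,
    Finset.card_finsuppAntidiag_nat_eq_choose, Finset.card_univ, Fintype.card_fin]
  rw [show m + 1 + k - 1 = k + m by omega, Nat.choose_symm_add]

instance (K : Type*) [Field K] (m k : ℕ) :
    Module.Finite K (homogeneousSubmodule (Fin (m + 1)) K k) :=
  Module.Finite.iff_fg.2 (homogeneousSubmodule_fg _ _ _)

section Integral

variable {σ ι K : Type*} [Field K] {F : ι → MvPolynomial σ K} {d : ℕ}

theorem IsHomogeneous.homogeneousComponent_mul {R : Type*} [CommRing R] {p q : MvPolynomial σ R}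
    {d : ℕ} (hq : q.IsHomogeneous d) (n : ℕ) :
    homogeneousComponent n (p * q) = if d ≤ n then homogeneousComponent (n - d) p * q else 0 := by
  rw [← coeff_gradingHom, map_mul, hq.gradingHom_eq, ← Polynomial.C_mul_X_pow_eq_monomial,
    ← mul_assoc, Polynomial.coeff_mul_X_pow', Polynomial.coeff_mul_C, coeff_gradingHom]

/-- If all forms of large degree lie in the ideal generated by forms of positive degree, then
the polynomial ring is a finite module over the subalgebra generated by them. -/
theorem finite_adjoin_of_mem_span [Finite σ] [Fintype ι] (hd : d ≠ 0)
    (hF : ∀ j, (F j).IsHomogeneous d) {B : ℕ}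
    (hB : ∀ n q, B ≤ n → IsHomogeneous q n → q ∈ Ideal.span (Set.range F)) :
    Module.Finite (Algebra.adjoin K (Set.range F)) (MvPolynomial σ K) := by
  set S := Algebra.adjoin K (Set.range F)
  have hfin := Finsupp.finite_of_degree_le (σ := σ) B
  set N : Submodule S (MvPolynomial σ K) :=
    Submodule.span S ((fun s => monomial s (1 : K)) '' {s | s.degree ≤ B}) with hN
  have hmon : ∀ s r, s.degree ≤ B → monomial s r ∈ N := by
    intro s r hs
    have : monomial s r = (algebraMap K S r) • monomial s (1 : K) := by
      rw [algebraMap_smul, smul_monomial, smul_eq_mul, mul_one]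
    rw [this]
    exact N.smul_mem _ (Submodule.subset_span ⟨s, hs, rfl⟩)
  have hmem : ∀ n q, IsHomogeneous q n → q ∈ N := by
    intro n
    induction n using Nat.strong_induction_on with
    | _ n ih =>
      intro q hq
      rcases le_total n B with hn | hn
      · rw [q.as_sum]
        refine N.sum_mem fun s hs => hmon s _ ?_
        have : s.degree = n := by
          by_contra hne
          exact (mem_support_iff.1 hs) (hq.coeff_eq_zero hne)
        omega
      · obtain ⟨c, hc⟩ := (Submodule.mem_span_range_iff_exists_fun _).1 (hB n q hn hq)
        -- In the degree `n` part, the coefficients become forms of degree `n - d < n`, to which the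
        -- induction applies.
        have hsum : q = ∑ j, homogeneousComponent n (c j * F j) := by
          rw [← map_sum, ← homogeneousComponent_eq_self hq]
          simp only [smul_eq_mul] at hc
          rw [hc, homogeneousComponent_eq_self hq]
        rw [hsum]
        refine N.sum_mem fun j _ => ?_
        rw [(hF j).homogeneousComponent_mul]
        split_ifs with hdn
        · have hmul : homogeneousComponent (n - d) (c j) * F j =
              (⟨F j, Algebra.subset_adjoin ⟨j, rfl⟩⟩ : S) • homogeneousComponent (n - d) (c j) :=
            mul_comm _ _
          rw [hmul]
          exact N.smul_mem _ (ih (n - d) (by omega) _ (homogeneousComponent_isHomogeneous _ _))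
        · exact N.zero_mem
  have htop : N = ⊤ := by
    refine eq_top_iff.2 fun p _ => ?_
    rw [← sum_homogeneousComponent p]
    exact N.sum_mem fun n _ => hmem n _ (homogeneousComponent_isHomogeneous _ _)
  exact ⟨htop ▸ Submodule.fg_span (hfin.image _)⟩

/-- By the Nullstellensatz: each variable vanishes at the origin, the only possible common zero. -/
theorem X_pow_mem_span [IsAlgClosed K] [Finite σ] (h : ∀ x, (∀ j, eval x (F j) = 0) → x = 0)
    (i : σ) : ∃ r, (X i : MvPolynomial σ K) ^ r ∈ Ideal.span (Set.range F) := by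
  change X i ∈ (Ideal.span (Set.range F)).radical
  rw [← vanishingIdeal_zeroLocus_eq_radical (k := K) (K := K), mem_vanishingIdeal_iff]
  intro x hx
  rw [zeroLocus_span] at hx
  rw [aeval_X, h x fun j => ?_, Pi.zero_apply]
  rw [← aeval_eq_eval]
  exact hx _ ⟨j, rfl⟩

theorem exists_forall_mem_span [IsAlgClosed K] [Fintype σ]
    (h : ∀ x, (∀ j, eval x (F j) = 0) → x = 0) :
    ∃ B, ∀ n q, B ≤ n → IsHomogeneous q n → q ∈ Ideal.span (Set.range F) := by
  choose r hr using X_pow_mem_span h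
  -- Pigeonhole: a monomial of degree above `∑ i, r i` has some exponent at least `r i`.
  refine ⟨∑ i, r i + 1, fun n q hn hq => ?_⟩
  rw [q.as_sum]
  refine Ideal.sum_mem _ fun s hs => ?_
  have hdeg : s.degree = n := by
    by_contra hne
    exact (mem_support_iff.1 hs) (hq.coeff_eq_zero hne)
  obtain ⟨i, hi⟩ : ∃ i, r i ≤ s i := by
    by_contra! hlt
    have := Finset.sum_le_sum fun i (_ : i ∈ Finset.univ) => (hlt i).le
    rw [← Finsupp.degree_eq_sum] at this
    omega
  rw [monomial_eq, Finsupp.prod_fintype _ _ (by simp)]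
  refine Ideal.mul_mem_left _ _
    (Ideal.mem_of_dvd _ (Finset.dvd_prod_of_mem _ (Finset.mem_univ i)) ?_)
  exact Ideal.mem_of_dvd _ (pow_dvd_pow _ hi) (hr i)

/-- Among forms of equal positive degree without common zero, as many as there are variables are
algebraically independent. -/
theorem exists_algebraicIndependent [IsAlgClosed K] [Fintype σ] [Fintype ι] (hd : d ≠ 0)
    (hF : ∀ j, (F j).IsHomogeneous d) (h : ∀ x, (∀ j, eval x (F j) = 0) → x = 0) :
    ∃ u : σ → ι, Function.Injective u ∧ AlgebraicIndependent K (F ∘ u) := by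
  obtain ⟨B, hB⟩ := exists_forall_mem_span h
  have := finite_adjoin_of_mem_span hd hF hB
  have : Algebra.IsIntegral (Algebra.adjoin K (Set.range F)) (MvPolynomial σ K) :=
    Algebra.IsIntegral.of_finite _ _
  -- By integrality the forms contain a transcendence basis, which has as many elements as there are
  -- variables.
  obtain ⟨t, ht, hb⟩ := exists_isTranscendenceBasis_subset (R := K) (Set.range F)
  have hcard := (IsTranscendenceBasis.mvPolynomial σ K).lift_cardinalMk_eq hb
  obtain ⟨e⟩ := Cardinal.lift_mk_eq'.1 hcard
  choose v hv using fun i => ht (e i).2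
  have hcomp : F ∘ v = ((↑) : t → MvPolynomial σ K) ∘ e := _root_.funext hv
  have hind : AlgebraicIndependent K (F ∘ v) := hcomp ▸ hb.1.comp e e.injective
  exact ⟨v, hind.injective.of_comp, hind⟩

end Integral

end MvPolynomial

/-! ### The bound for the number of symmetries -/

/-- Both sides are polynomials in `k`, with coefficients $N/m!$ and $d^m/m!$ at $k^m$; divide by
$k^m$ and let $k\to\infty$. -/
theorem Nat.le_pow_of_forall_mul_choose_le {N d a m : ℕ}
    (h : ∀ k, N * (k + m).choose m ≤ (d * k + a + m).choose m) : N ≤ d ^ m := by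
  have h1 : ∀ k : ℕ, N * k ^ m ≤ (d * k + (a + m)) ^ m := by
    intro k
    have h2 : k ^ m ≤ m.factorial * (k + m).choose m := by
      rw [← Nat.ascFactorial_eq_factorial_mul_choose]
      exact (Nat.pow_le_pow_left (Nat.le_succ k) m).trans (Nat.pow_succ_le_ascFactorial _ _)
    have h3 : m.factorial * (d * k + a + m).choose m ≤ (d * k + (a + m)) ^ m := by
      rw [← Nat.descFactorial_eq_factorial_mul_choose, ← add_assoc]
      exact Nat.descFactorial_le_pow _ _
    calc N * k ^ m ≤ N * (m.factorial * (k + m).choose m) := Nat.mul_le_mul_left _ h2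
      _ = m.factorial * (N * (k + m).choose m) := by ring
      _ ≤ m.factorial * (d * k + a + m).choose m := Nat.mul_le_mul_left _ (h k)
      _ ≤ _ := h3
  have hlim : Filter.Tendsto (fun k : ℕ => ((d : ℝ) + ((a + m : ℕ) : ℝ) / (k : ℝ)) ^ m)
      Filter.atTop (nhds (((d : ℝ) + 0) ^ m)) :=
    (tendsto_const_nhds.add (tendsto_const_div_atTop_nhds_zero_nat _)).pow m
  have hle : (N : ℝ) ≤ ((d : ℝ) + 0) ^ m := by
    refine ge_of_tendsto hlim ?_
    filter_upwards [Filter.eventually_gt_atTop 0] with k hk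
    have hk' : (0 : ℝ) < k := by exact_mod_cast hk
    have h4 : (N : ℝ) * k ^ m ≤ (d * k + ((a + m : ℕ) : ℝ)) ^ m := by exact_mod_cast h1 k
    rw [show (d : ℝ) + ((a + m : ℕ) : ℝ) / k = (d * k + ((a + m : ℕ) : ℝ)) / k by field_simp,
      div_pow, le_div_iff₀ (by positivity)]
    exact h4
  rw [add_zero] at hle
  exact_mod_cast hle

namespace ProjectiveMaps

variable {K : Type*} [Field K] {m n : ℕ}

/-- Pairwise distinct points of projective space are separated by forms. -/
theorem exists_separating_forms {ι : Type*} [Fintype ι] (y : ι → Fin (m + 1) → K)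
    (hy : ∀ i j, i ≠ j → ∃ a b, y i a * y j b ≠ y i b * y j a) :
    ∃ h : ι → MvPolynomial (Fin (m + 1)) K,
      (∀ j, (h j).IsHomogeneous (Fintype.card ι - 1)) ∧
      (∀ i j, i ≠ j → eval (y i) (h j) = 0) ∧ ∀ j, eval (y j) (h j) ≠ 0 := by
  classical
  choose! a b hab using hy
  -- A linear form that vanishes at `y i` and, for `i ≠ j`, not at `y j`.
  let ℓ : ι → ι → MvPolynomial (Fin (m + 1)) K := fun i j =>
    C (y i (a i j)) * X (b i j) - C (y i (b i j)) * X (a i j)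
  refine ⟨fun j => ∏ i ∈ Finset.univ.erase j, ℓ i j, fun j => ?_, fun i j hij => ?_, fun j => ?_⟩
  · have := IsHomogeneous.prod (Finset.univ.erase j) (fun i => ℓ i j) (fun _ => 1)
      fun i _ => (isHomogeneous_C_mul_X _ _).sub (isHomogeneous_C_mul_X _ _)
    simpa using this
  · rw [map_prod]
    refine Finset.prod_eq_zero (Finset.mem_erase.2 ⟨hij, Finset.mem_univ i⟩) ?_
    simp only [ℓ, map_sub, map_mul, eval_C, eval_X]
    ring
  · rw [map_prod, Finset.prod_ne_zero_iff]
    intro i hi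
    simp only [ℓ, map_sub, map_mul, eval_C, eval_X]
    exact sub_ne_zero.2 (hab i j (Finset.ne_of_mem_erase hi))

/-- Pairwise distinct projective transformations take distinct values at some point. -/
theorem exists_point_of_not_equiv [Infinite K] {ι : Type*} [Fintype ι]
    (A : ι → GL (Fin (m + 1)) K)
    (hA : ∀ i j, i ≠ j → ¬ FormTuple.ofGL (A i) ≈ FormTuple.ofGL (A j)) :
    ∃ x : Fin (m + 1) → K, ∀ i j, i ≠ j → ∃ a b,
      (FormTuple.ofGL (A i)).eval x a * (FormTuple.ofGL (A j)).eval x b ≠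
        (FormTuple.ofGL (A i)).eval x b * (FormTuple.ofGL (A j)).eval x a := by
  classical
  have hne : ∀ i j, i ≠ j → ∃ a b,
      (FormTuple.ofGL (A i)).forms a * (FormTuple.ofGL (A j)).forms b -
        (FormTuple.ofGL (A i)).forms b * (FormTuple.ofGL (A j)).forms a ≠ 0 := by
    intro i j hij
    by_contra! h
    exact hA i j hij fun a b => sub_eq_zero.1 (h a b)
  choose! a b hab using hne
  -- One nonzero minor per pair; over an infinite field their product is nonzero at some point.
  have hprod := Finset.prod_ne_zero_iff.2 fun (p : ι × ι) (hp : p ∈ Finset.univ.offDiag) =>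
    hab p.1 p.2 (Finset.mem_offDiag.1 hp).2.2
  obtain ⟨x, hx⟩ : ∃ x, eval x (∏ p ∈ (Finset.univ : Finset ι).offDiag,
      ((FormTuple.ofGL (A p.1)).forms (a p.1 p.2) * (FormTuple.ofGL (A p.2)).forms (b p.1 p.2) -
        (FormTuple.ofGL (A p.1)).forms (b p.1 p.2) *
          (FormTuple.ofGL (A p.2)).forms (a p.1 p.2))) ≠ 0 := by
    by_contra! h
    exact hprod (MvPolynomial.funext fun x => by rw [h, map_zero])
  refine ⟨x, fun i j hij => ⟨a i j, b i j, ?_⟩⟩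
  rw [map_prod, Finset.prod_ne_zero_iff] at hx
  have := hx (i, j) (Finset.mem_offDiag.2 ⟨Finset.mem_univ _, Finset.mem_univ _, hij⟩)
  rw [map_sub, map_mul, map_mul, sub_ne_zero] at this
  exact this

/-- A bound for the number of projective transformations that preserve forms without common zero,
up to constants. The translates of suitable forms `h i` are linearly independent over the forms
in the `F j`, and one compares dimensions in large degrees. -/
theorem FormTuple.card_le_degree_pow [IsAlgClosed K] {F : FormTuple K m n} (hd : F.degree ≠ 0)
    (hz : F.NoCommonZero) {ι : Type*} [Fintype ι] (A : ι → GL (Fin (m + 1)) K)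
    (hA : ∀ i j, i ≠ j → ¬ ofGL (A i) ≈ ofGL (A j)) (c : ι → K) (hc : ∀ i, c i ≠ 0)
    (hF : ∀ i j, bind₁ (ofGL (A i)).forms (F.forms j) = C (c i) * F.forms j) :
    Fintype.card ι ≤ F.degree ^ n := by
  classical
  obtain ⟨u, hu, hind⟩ := exists_algebraicIndependent hd F.homogeneous
    fun x hx => hz x (_root_.funext hx)
  have hmn : m ≤ n := by simpa using Fintype.card_le_of_injective u hu
  have : Infinite K := IsAlgClosed.instInfinite
  obtain ⟨x, hx⟩ := exists_point_of_not_equiv A hA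
  obtain ⟨h, hhom, hzero, hone⟩ := exists_separating_forms (fun i => (ofGL (A i)).eval x) hx
  let D : Matrix ι ι (MvPolynomial (Fin (m + 1)) K) :=
    Matrix.of fun i j => bind₁ (ofGL (A i)).forms (h j)
  -- At `x` the matrix is diagonal with nonzero entries, because `h j` separates the points $A_ix$.
  have hD : D.det ≠ 0 := by
    intro h0
    have h1 := congrArg (MvPolynomial.eval x) h0
    have hdiag : (MvPolynomial.eval x).mapMatrix D =
        Matrix.diagonal fun i => MvPolynomial.eval ((ofGL (A i)).eval x) (h i) := by
      ext i j
      have e : MvPolynomial.eval x (D i j) = MvPolynomial.eval ((ofGL (A i)).eval x) (h j) := by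
        simp only [D, Matrix.of_apply]
        rw [← aeval_eq_eval, aeval_bind₁]
        rfl
      rw [RingHom.mapMatrix_apply, Matrix.map_apply, e, Matrix.diagonal_apply]
      split_ifs with hij
      · rw [hij]
      · exact hzero i j hij
    rw [RingHom.map_det, hdiag, Matrix.det_diagonal, map_zero] at h1
    exact Finset.prod_ne_zero_iff.2 (fun i _ => hone i) h1
  refine (Nat.le_pow_of_forall_mul_choose_le (a := Fintype.card ι - 1) fun k => ?_).trans
    (Nat.pow_le_pow_right (Nat.pos_of_ne_zero hd) hmn)
  let L : (ι → homogeneousSubmodule (Fin (m + 1)) K k) →ₗ[K] MvPolynomial (Fin (m + 1)) K :=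
    ∑ j, (LinearMap.mulLeft K (h j)) ∘ₗ (aeval (F.forms ∘ u)).toLinearMap ∘ₗ
      (homogeneousSubmodule (Fin (m + 1)) K k).subtype ∘ₗ LinearMap.proj j
  have hL : ∀ p, L p = ∑ j, h j * aeval (F.forms ∘ u) (p j).1 := fun p => by
    simp [L]
  have hmem : ∀ p, L p ∈ homogeneousSubmodule (Fin (m + 1)) K
      (F.degree * k + (Fintype.card ι - 1)) := by
    intro p
    rw [hL, add_comm (_ * _)]
    exact Submodule.sum_mem _ fun j _ =>
      (hhom j).mul ((p j).2.aeval _ fun i => F.homogeneous (u i))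
  have hinj : Function.Injective (L.codRestrict _ hmem) := by
    rw [injective_iff_map_eq_zero]
    intro p hp
    have h0 : L p = 0 := congrArg Subtype.val hp
    rw [hL] at h0
    -- Applying `A i` multiplies every `p j (F ∘ u)` by the same `c i ^ k`, which cancels; only the
    -- `h j` change.
    have hker : D.mulVec (fun j => aeval (F.forms ∘ u) (p j).1) = 0 := by
      funext i
      have h1 := congrArg (bind₁ (ofGL (A i)).forms) h0
      have h2 : ∀ j, bind₁ (ofGL (A i)).forms (aeval (F.forms ∘ u) (p j).1) =
          C (c i) ^ k * aeval (F.forms ∘ u) (p j).1 := by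
        intro j
        have h3 := (p j).2.aeval_mul (C (c i)) (F.forms ∘ u)
        rw [← h3, ← AlgHom.comp_apply, comp_aeval]
        simp only [Function.comp_apply, hF]
      simp only [map_sum, map_mul, h2, map_zero] at h1
      refine (mul_eq_zero.1 (?_ : C (c i) ^ k * _ = 0)).resolve_left
        (pow_ne_zero _ (C_ne_zero.2 (hc i)))
      rw [← h1, Matrix.mulVec, dotProduct, Finset.mul_sum]
      exact Finset.sum_congr rfl fun j _ => mul_left_comm _ _ _
    have hzero := Matrix.eq_zero_of_mulVec_eq_zero hD hker
    funext j
    refine Subtype.ext (hind ?_)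
    rw [congrFun hzero j]
    simp
  have := LinearMap.finrank_le_finrank_of_injective hinj
  rw [Module.finrank_pi_fintype] at this
  simpa [finrank_homogeneousSubmodule] using this

/-- The matrices that preserve a tuple of forms up to a constant. -/
def FormTuple.stabilizer (F : FormTuple K m n) : Subgroup (GL (Fin (m + 1)) K) where
  carrier := {A | ∃ c : K, c ≠ 0 ∧ ∀ j, bind₁ (ofGL A).forms (F.forms j) = C c * F.forms j}
  one_mem' := ⟨1, one_ne_zero, fun j => by rw [bind₁_ofGL_one, map_one, one_mul]⟩
  mul_mem' := by
    rintro A B ⟨a, ha, hA⟩ ⟨b, hb, hB⟩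
    refine ⟨a * b, mul_ne_zero ha hb, fun j => ?_⟩
    rw [bind₁_ofGL_mul, hA, map_mul, bind₁_C_right, hB, map_mul, mul_assoc]
  inv_mem' := by
    rintro A ⟨a, ha, hA⟩
    refine ⟨a⁻¹, inv_ne_zero ha, fun j => ?_⟩
    have h := bind₁_ofGL_inv_bind₁ A (F.forms j)
    rw [hA, map_mul, bind₁_C_right] at h
    rw [← h, ← mul_assoc, ← map_mul, inv_mul_cancel₀ ha, map_one, one_mul, h]

namespace RationalMap

theorem ofPGL_image_stabilizer [IsAlgClosed K] {f : RationalMap K m n} {F : FormTuple K m n}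
    (hF : Represents F f) (cF : F.IsCoprime) (zF : F.NoCommonZero) (hd : F.degree ≠ 0) :
    ofPGL '' (F.stabilizer.map Matrix.ProjGenLinGroup.mk : Set PGL(Fin (m + 1), K)) =
      f.symmetries := by
  ext φ
  constructor
  · rintro ⟨_, ⟨A, ⟨c, hc, hA⟩, rfl⟩, rfl⟩
    refine ⟨F, FormTuple.ofGL A, F.compGL A, hF, represents_ofGL A, ?_, fun j => rfl⟩
    refine hF.of_equiv fun i j => ?_
    change bind₁ _ _ * _ = bind₁ _ _ * _
    rw [hA, hA]
    ring
  · intro hφ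
    -- Comparing degrees in $f\circ\varphi=f$ and cancelling `F.degree ≠ 0` gives $\deg\varphi=1$.
    obtain ⟨A, hA, hc⟩ := IsComp.exists_ofGL hφ hF hF cF cF zF zF
      (fun h => Nat.eq_of_mul_eq_mul_right (Nat.pos_of_ne_zero hd) (h.trans (one_mul _).symm)) hd
    exact ⟨_, ⟨A, hc, rfl⟩, hA⟩

end RationalMap

theorem FormTuple.finite_stabilizer [IsAlgClosed K] {F : FormTuple K m n}
    (zF : F.NoCommonZero) (hd : F.degree ≠ 0) :
    Finite (F.stabilizer.map Matrix.ProjGenLinGroup.mk) ∧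
      Nat.card (F.stabilizer.map Matrix.ProjGenLinGroup.mk) ≤ F.degree ^ n := by
  set G := F.stabilizer.map Matrix.ProjGenLinGroup.mk
  -- The bound applies to any finite set of symmetries, so it yields finiteness as well.
  have key : ∀ s : Finset G, s.card ≤ F.degree ^ n := by
    intro s
    choose A hA hmk using fun g : s => g.1.2
    choose c hc hF using hA
    rw [← Fintype.card_coe]
    refine FormTuple.card_le_degree_pow hd zF A (fun i j hij h => hij ?_) c hc hF
    have := RationalMap.mk_eq_mk_of_equiv h
    rw [hmk, hmk] at this
    exact Subtype.ext (Subtype.ext this)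
  have hfin : Finite G := by
    by_contra hinf
    rw [not_finite_iff_infinite] at hinf
    obtain ⟨s, hs⟩ := Infinite.exists_subset_card_eq G (F.degree ^ n + 1)
    have := key s
    omega
  refine ⟨hfin, ?_⟩
  have := Fintype.ofFinite G
  rw [Nat.card_eq_fintype_card]
  exact key Finset.univ

end ProjectiveMaps

/-- The chain rule for partial derivatives. -/
theorem MvPolynomial.pderiv_bind₁ {σ τ R : Type*} [CommRing R] [Fintype σ]
    (g : σ → MvPolynomial τ R) (p : MvPolynomial σ R) (i : τ) :
    pderiv i (bind₁ g p) = ∑ k, bind₁ g (pderiv k p) * pderiv i (g k) := by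
  classical
  induction p using MvPolynomial.induction_on with
  | C a => simp
  | add p q hp hq => simp only [map_add, hp, hq, add_mul, Finset.sum_add_distrib]
  | mul_X p s hp =>
    simp only [map_mul, bind₁_X_right, pderiv_mul, hp, map_add, add_mul, Finset.sum_add_distrib,
      Finset.sum_mul, pderiv_X]
    congr 1
    · exact Finset.sum_congr rfl fun k _ => mul_right_comm _ _ _
    · rw [Finset.sum_eq_single s]
      · simp
      · intro b _ hb
        simp [hb.symm]
      · simp

/-! ### Symmetries and the critical locus -/

namespace ProjectiveMaps

variable {K : Type*} [Field K] {m n : ℕ}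

theorem FormTuple.jacobian_compGL (Φ : FormTuple K m n) (A : GL (Fin (m + 1)) K)
    (x : Fin (m + 1) → K) :
    (Φ.compGL A).jacobian x = Φ.jacobian (A.val.mulVec x) ∘ₗ Matrix.toLin' A.val := by
  rw [jacobian, jacobian, ← Matrix.toLin'_mul]
  congr 1
  ext j i
  have hp : ∀ k, pderiv i ((ofGL A).forms k) = C (A.val k i) := by
    intro k
    simp only [ofGL, map_sum, pderiv_C_mul]
    rw [Finset.sum_eq_single i]
    · simp
    · intro b _ hb
      rw [pderiv_X_of_ne hb, mul_zero]
    · simp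
  simp only [compGL, comp, Matrix.mul_apply, Matrix.of_apply, pderiv_bind₁, map_sum, map_mul, hp,
    eval_C]
  refine Finset.sum_congr rfl fun k _ => ?_
  rw [← eval_ofGL, ← aeval_eq_eval, aeval_bind₁]
  rfl

theorem FormTuple.range_differential (Φ : FormTuple K m n) (x : Fin (m + 1) → K) :
    LinearMap.range (Φ.differential x) =
      (LinearMap.range (Φ.jacobian x)).map (Submodule.span K {Φ.eval x}).mkQ := by
  rw [differential, Submodule.range_mapQ]

/-- Since `A` is surjective, the two Jacobians have the same range, and it is taken modulo the same
line. -/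
theorem FormTuple.finrank_range_differential_compGL (Φ : FormTuple K m n)
    (A : GL (Fin (m + 1)) K) (x : Fin (m + 1) → K) :
    Module.finrank K (LinearMap.range ((Φ.compGL A).differential x)) =
      Module.finrank K (LinearMap.range (Φ.differential (A.val.mulVec x))) := by
  have hA : LinearMap.range (Matrix.toLin' A.val) = ⊤ := by
    refine LinearMap.range_eq_top.2 fun y => ⟨A⁻¹.val.mulVec y, ?_⟩
    rw [Matrix.toLin'_apply, Matrix.mulVec_mulVec, ← Units.val_mul, mul_inv_cancel,
      Units.val_one, Matrix.one_mulVec]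
  rw [range_differential, range_differential, jacobian_compGL, LinearMap.range_comp, hA,
    Submodule.map_top, eval_compGL]

namespace RationalMap

/-- A critical point may be witnessed by any tuple `Φ` for `f`, so invariance is carried over from
`F` to `Φ`. -/
theorem Represents.compGL {f : RationalMap K m n} {F Φ : FormTuple K m n} (hF : Represents F f)
    (hΦ : Represents Φ f) {A : GL (Fin (m + 1)) K} (hA : A ∈ F.stabilizer) :
    Represents (Φ.compGL A) f := by
  obtain ⟨c, hc, hA⟩ := hA
  refine hF.of_equiv (Setoid.trans (b := F.compGL A) (fun i j => ?_) fun i j => ?_)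
  · have := congrArg (bind₁ (FormTuple.ofGL A).forms) (hΦ.equiv hF i j)
    rwa [map_mul, map_mul] at this
  · change bind₁ _ _ * _ = bind₁ _ _ * _
    rw [hA, hA]
    ring

theorem mapsPoint_ofGL_iff (A : GL (Fin (m + 1)) K) {x : Fin (m + 1) → K} (hx : x ≠ 0)
    (Q : PSpace K m) :
    (ofPGL (Matrix.ProjGenLinGroup.mk A)).MapsPoint (Projectivization.mk K x hx) Q ↔
      Q = Projectivization.mk K (A.val.mulVec x) (FormTuple.mulVec_ne_zero A hx) := by
  constructor
  · rintro ⟨Φ, y, hy, hne, hΦ, hxy, rfl⟩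
    obtain ⟨a, rfl⟩ := (Projectivization.mk_eq_mk_iff' _ _ _ _ _).1 hxy
    obtain ⟨k, hk⟩ := Function.ne_iff.1 (FormTuple.mulVec_ne_zero A hy)
    rw [Pi.zero_apply] at hk
    have hprop : ∀ i, Φ.eval y i * A.val.mulVec y k = Φ.eval y k * A.val.mulVec y i := by
      intro i
      have := congrArg (eval y) (hΦ.equiv (represents_ofGL A) i k)
      rw [map_mul, map_mul] at this
      rw [← FormTuple.eval_ofGL]
      exact this
    have ha : a ≠ 0 := by
      rintro rfl
      exact hx (zero_smul _ _)
    rw [Projectivization.mk_eq_mk_iff']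
    -- The quotient compares `Φ.eval y` with $Ay$; `a⁻¹` undoes the change of representative from
    -- `y` to `a • y`.
    refine ⟨Φ.eval y k / A.val.mulVec y k * a⁻¹, ?_⟩
    funext i
    rw [Matrix.mulVec_smul, smul_smul, inv_mul_cancel_right₀ ha, Pi.smul_apply, smul_eq_mul,
      div_mul_eq_mul_div, ← hprop, mul_div_cancel_right₀ _ hk]
  · rintro rfl
    refine ⟨FormTuple.ofGL A, x, hx, ?_, represents_ofGL A, rfl, ?_⟩
    · rw [FormTuple.eval_ofGL]
      exact FormTuple.mulVec_ne_zero A hx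
    · simp only [FormTuple.eval_ofGL]

theorem mulVec_mem_criticalLocus {f : RationalMap K m n} {F : FormTuple K m n}
    (hF : Represents F f) {A : GL (Fin (m + 1)) K} (hA : A ∈ F.stabilizer)
    {x : Fin (m + 1) → K} (hx : x ≠ 0) (h : Projectivization.mk K x hx ∈ f.criticalLocus) :
    Projectivization.mk K (A.val.mulVec x) (FormTuple.mulVec_ne_zero A hx) ∈ f.criticalLocus := by
  obtain ⟨Φ, y, hy, hne, hΦ, hxy, hrank⟩ := h
  have hinv : A⁻¹.val.mulVec (A.val.mulVec y) = y := by
    rw [Matrix.mulVec_mulVec, ← Units.val_mul, inv_mul_cancel, Units.val_one, Matrix.one_mulVec]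
  refine ⟨Φ.compGL A⁻¹, A.val.mulVec y, FormTuple.mulVec_ne_zero A hy, ?_,
    hF.compGL hΦ (inv_mem hA), ?_, ?_⟩
  · rwa [FormTuple.eval_compGL, hinv]
  · obtain ⟨a, ha⟩ := (Projectivization.mk_eq_mk_iff' _ _ _ _ _).1 hxy
    refine (Projectivization.mk_eq_mk_iff' _ _ _ _ _).2 ⟨a, ?_⟩
    rw [← Matrix.mulVec_smul, ha]
  · rwa [FormTuple.finrank_range_differential_compGL, hinv]

/-- One inclusion for `A` and one for `A⁻¹`, which also preserves `F` up to a constant. -/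
theorem image_criticalLocus {f : RationalMap K m n} {F : FormTuple K m n}
    (hF : Represents F f) {A : GL (Fin (m + 1)) K} (hA : A ∈ F.stabilizer) :
    (ofPGL (Matrix.ProjGenLinGroup.mk A)).image f.criticalLocus = f.criticalLocus := by
  ext Q
  constructor
  · rintro ⟨P, hP, hPQ⟩
    induction P using Projectivization.ind with
    | h x hx =>
      rw [(mapsPoint_ofGL_iff A hx Q).1 hPQ]
      exact mulVec_mem_criticalLocus hF hA hx hP
  · intro hQ
    induction Q using Projectivization.ind with
    | h y hy =>
      refine ⟨_, mulVec_mem_criticalLocus hF (inv_mem hA) hy hQ, ?_⟩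
      rw [mapsPoint_ofGL_iff]
      simp only [Matrix.mulVec_mulVec, ← Units.val_mul, mul_inv_cancel, Units.val_one,
        Matrix.one_mulVec]

theorem IsMorphism.isConstant {f : RationalMap K 0 n} (hf : f.IsMorphism) : f.IsConstant := by
  have h1 : (fun _ => 1 : Fin 1 → K) ≠ 0 := fun h => one_ne_zero (congrFun h 0)
  have hP : Projectivization.mk K _ h1 ∈ f.domain := hf ▸ Set.mem_univ _
  obtain ⟨Q, hQ⟩ := hP
  refine ⟨Q, fun P _ => ?_⟩
  induction P using Projectivization.ind with
  | h x hx =>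
    convert hQ using 1
    refine (Projectivization.mk_eq_mk_iff' _ _ _ _ _).2 ⟨x 0, ?_⟩
    funext i
    rw [show i = 0 from Subsingleton.elim (α := Fin 1) i 0, Pi.smul_apply, smul_eq_mul, mul_one]

end RationalMap

end ProjectiveMaps

theorem proposition2p3 {K : Type*} [Field K] [IsAlgClosed K] {m M : ℕ}
    (f : ProjectiveMaps.RationalMap K m M) (hf : f.IsMorphism) (hnc : ¬ f.IsConstant) :
    -- `PGL` is identified with the group of automorphisms of projective space
    (Set.BijOn (ProjectiveMaps.RationalMap.ofPGL (K := K) (m := m)) Set.univ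
        (ProjectiveMaps.RationalMap.automorphisms K m) ∧
      ∀ g h : PGL(Fin (m + 1), K), ProjectiveMaps.RationalMap.IsComp
        (ProjectiveMaps.RationalMap.ofPGL g) (ProjectiveMaps.RationalMap.ofPGL h)
        (ProjectiveMaps.RationalMap.ofPGL (g * h))) ∧
    -- the mapping symmetries form a finite subgroup of bounded order
    (∃ G : Subgroup PGL(Fin (m + 1), K), Finite G ∧ Nat.card G ≤ f.degree ^ M ∧
      ProjectiveMaps.RationalMap.ofPGL '' (G : Set PGL(Fin (m + 1), K)) = f.symmetries) ∧
    -- every mapping symmetry preserves the critical locus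
    (∀ φ ∈ f.symmetries, φ.image f.criticalLocus = f.criticalLocus) := by
  have hm : m ≠ 0 := by
    rintro rfl
    exact hnc hf.isConstant
  obtain ⟨F, hF, cF, hFd⟩ := f.exists_isCoprime
  have hd := ProjectiveMaps.RationalMap.degree_ne_zero_of_not_isConstant hnc hF
  have zF := hf.noCommonZero hF cF
  have hG := ProjectiveMaps.RationalMap.ofPGL_image_stabilizer hF cF zF hd
  obtain ⟨hfin, hcard⟩ := F.finite_stabilizer zF hd
  refine ⟨⟨ProjectiveMaps.RationalMap.bijOn_ofPGL hm, ProjectiveMaps.RationalMap.isComp_ofPGL⟩,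
    ⟨_, hfin, hFd ▸ hcard, hG⟩, fun φ hφ => ?_⟩
  rw [← hG] at hφ
  obtain ⟨_, ⟨A, hA, rfl⟩, rfl⟩ := hφ
  exact ProjectiveMaps.RationalMap.image_criticalLocus hF hA
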